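/- Fix the following model of computation: a unit-cost real RAM whose programs are built from assignments, sequencing, conditionals and while-loops; it has integer registers (with integer addition, truncated subtraction and comparison, used in particular for array indices) and registers and arrays of real numbers, with exact real arithmetic $+,-,\times,/$, square roots, comparisons and rational constants; every elementary operation costs one step. For $c_1,\dots,c_n\in\mathbb{R}^d$ and $r_1,\dots,r_n\ge 0$ let $\Omega_i=\{v\in\mathbb{R}^d:\|v-c_i\|\le r_i\}$. A ball $B(z,r)$ with $r\ge 0$ is an intersecting ball of $\Omega_1,\dots,\Omega_n$ if $B(z,r)\cap\Omega_i\neq\varnothing$ for all $i$. Let $r^*$ be the smallest radius of an intersecting ball. For $\varepsilon>0$, a $(1+\varepsilon)$-approximate smallest intersecting ball (SIB) is an intersecting ball $B(z,r)$ with $r\le(1+\varepsilon)r^*$. Let $D$ be the diameter of the convex hull of $\Omega_1\cup\dots\cup\Omega_n$. When $\bigcap_i\Omega_i=\varnothing$ (so that $n>1$, $d\ge 1$ and $r^*>0$), let $R=D/r^*$. 1. For every $c\in\mathbb{R}^d$, $r\ge 0$ and $h\in\mathbb{R}^d\setminus\{0\}$, the point $c-r\,h/\|h\|$ minimizes $u\mapsto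 h^Tu$ over the ball $\{u:\|u-c\|\le r\}$. 2. There is a program that, for all $n,d\ge 1$, given $n$, $d$, $c_1,\dots,c_n$, $r_1,\dots,r_n\ge 0$ and $h_1,\dots,h_n\in\mathbb{R}^d$, computes in $O(nd)$ steps points $u_1,\dots,u_n$ such that $u_i$ minimizes $h_i^Tu$ over $u\in\Omega_i$ for every $i$, and $u_i=c_i-r_i\,h_i/\|h_i\|$ whenever $h_i\neq 0$. 3. There is a program that, given $n$, $d$, $c_1,\dots,c_n$, $r_1,\dots,r_n\ge 0$ with $\bigcap_i\Omega_i=\varnothing$, and $\varepsilon>0$ (but neither $D$ nor $r^*$), computes a $(1+\varepsilon)$-approximate SIB of $\Omega_1,\dots,\Omega_n$ in $$O\!\left(\frac{R^2\,nd\,\log n}{\min(\varepsilon,1)^2}\right)$$ steps; for $\varepsilon\le 1$ this is $O(R^2nd\log n/\varepsilon^2)$. In 2 and 3 the program and the constant in the $O$ are absolute: they do not depend on $n$, $d$, $\varepsilon$ or the balls. -/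

import Mathlib

/-! ### A unit-cost real RAM -/

namespace RealRAM

/-- A memory state: integer registers, real registers, and arrays of real cells.
Registers and arrays are named by numerals in the program text, so that a program uses only
finitely many of them; array cells are addressed by computed indices. -/
structure State where
  natReg : ℕ → ℕ
  realReg : ℕ → ℝ
  array : ℕ → ℕ → ℝ

/-- Integer (index) expressions. There is no unit-cost multiplication of integers. -/
inductive NatExpr where
  | const (k : ℕ)
  | reg (x : ℕ)
  | add (e f : NatExpr)
  | sub (e f : NatExpr)

/-- Real expressions: rational constants, registers, array cells, the four arithmetic operations
and the square root. There is no rounding and no other transcendental or algebraic operation. -/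
inductive RealExpr where
  | const (q : ℚ)
  | reg (x : ℕ)
  | load (a : ℕ) (idx : NatExpr)
  | add (e f : RealExpr)
  | sub (e f : RealExpr)
  | mul (e f : RealExpr)
  | div (e f : RealExpr)
  | sqrt (e : RealExpr)

/-- Tests: comparisons of integers and of reals, and their Boolean combinations. -/
inductive Test where
  | natLt (e f : NatExpr)
  | realLt (e f : RealExpr)
  | not (b : Test)
  | and (b c : Test)

/-- Programs. -/
inductive Cmd where
  | skip
  | setNat (x : ℕ) (e : NatExpr)
  | setReal (x : ℕ) (e : RealExpr)
  | store (a : ℕ) (idx : NatExpr) (e : RealExpr)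
  | seq (p q : Cmd)
  | ite (b : Test) (p q : Cmd)
  | loop (b : Test) (p : Cmd)

/-- The value of an integer expression (subtraction is truncated at zero). -/
def NatExpr.eval (s : State) : NatExpr → ℕ
  | .const k => k
  | .reg x => s.natReg x
  | .add e f => e.eval s + f.eval s
  | .sub e f => e.eval s - f.eval s

/-- The number of steps to evaluate an integer expression: one for each node. -/
def NatExpr.cost : NatExpr → ℕ
  | .const _ => 1
  | .reg _ => 1
  | .add e f => e.cost + f.cost + 1
  | .sub e f => e.cost + f.cost + 1

/-- The exact value of a real expression. The machine's convention is that a division by zero and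
the square root of a negative number return zero. -/
noncomputable def RealExpr.eval (s : State) : RealExpr → ℝ
  | .const q => (q : ℝ)
  | .reg x => s.realReg x
  | .load a idx => s.array a (idx.eval s)
  | .add e f => e.eval s + f.eval s
  | .sub e f => e.eval s - f.eval s
  | .mul e f => e.eval s * f.eval s
  | .div e f => e.eval s / f.eval s
  | .sqrt e => Real.sqrt (e.eval s)

/-- The number of steps to evaluate a real expression: one for each node. -/
def RealExpr.cost : RealExpr → ℕ
  | .const _ => 1
  | .reg _ => 1
  | .load _ idx => idx.cost + 1
  | .add e f => e.cost + f.cost + 1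
  | .sub e f => e.cost + f.cost + 1
  | .mul e f => e.cost + f.cost + 1
  | .div e f => e.cost + f.cost + 1
  | .sqrt e => e.cost + 1

/-- The test is true in the given state. -/
def Test.Holds (s : State) : Test → Prop
  | .natLt e f => e.eval s < f.eval s
  | .realLt e f => e.eval s < f.eval s
  | .not b => ¬ b.Holds s
  | .and b c => b.Holds s ∧ c.Holds s

/-- The number of steps to evaluate a test. -/
def Test.cost : Test → ℕ
  | .natLt e f => e.cost + f.cost + 1
  | .realLt e f => e.cost + f.cost + 1
  | .not b => b.cost + 1
  | .and b c => b.cost + c.cost + 1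

/-- Write an integer register. -/
def State.setNat (s : State) (x : ℕ) (v : ℕ) : State :=
  { s with natReg := Function.update s.natReg x v }

/-- Write a real register. -/
def State.setReal (s : State) (x : ℕ) (v : ℝ) : State :=
  { s with realReg := Function.update s.realReg x v }

/-- Write one cell of an array. -/
def State.store (s : State) (a : ℕ) (k : ℕ) (v : ℝ) : State :=
  { s with array := Function.update s.array a (Function.update (s.array a) k v) }

/-- `Exec p s s' t`: the program `p`, started in the state `s`, halts in the state `s'` after
exactly `t` steps. -/
inductive Exec : Cmd → State → State → ℕ → Prop
  | skip (s : State) : Exec .skip s s 1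
  | setNat (s : State) (x : ℕ) (e : NatExpr) :
      Exec (.setNat x e) s (s.setNat x (e.eval s)) (e.cost + 1)
  | setReal (s : State) (x : ℕ) (e : RealExpr) :
      Exec (.setReal x e) s (s.setReal x (e.eval s)) (e.cost + 1)
  | store (s : State) (a : ℕ) (idx : NatExpr) (e : RealExpr) :
      Exec (.store a idx e) s (s.store a (idx.eval s) (e.eval s)) (idx.cost + e.cost + 1)
  | seq {p q : Cmd} {s s' s'' : State} {t t' : ℕ} :
      Exec p s s' t → Exec q s' s'' t' → Exec (.seq p q) s s'' (t + t')
  | iteTrue {b : Test} {p q : Cmd} {s s' : State} {t : ℕ} :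
      b.Holds s → Exec p s s' t → Exec (.ite b p q) s s' (b.cost + t + 1)
  | iteFalse {b : Test} {p q : Cmd} {s s' : State} {t : ℕ} :
      ¬ b.Holds s → Exec q s s' t → Exec (.ite b p q) s s' (b.cost + t + 1)
  | loopTrue {b : Test} {p : Cmd} {s s' s'' : State} {t t' : ℕ} :
      b.Holds s → Exec p s s' t → Exec (.loop b p) s' s'' t' →
        Exec (.loop b p) s s'' (b.cost + t + 1 + t')
  | loopFalse {b : Test} {p : Cmd} {s : State} :
      ¬ b.Holds s → Exec (.loop b p) s s (b.cost + 1)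

/-- The machine is deterministic: final state and number of steps are determined by the program
and the initial state. -/
theorem Exec.deterministic {p : Cmd} {s s₁ s₂ : State} {t₁ t₂ : ℕ}
    (h₁ : Exec p s s₁ t₁) (h₂ : Exec p s s₂ t₂) : s₁ = s₂ ∧ t₁ = t₂ := by
  induction h₁ generalizing s₂ t₂ with
  | skip s => cases h₂; exact ⟨rfl, rfl⟩
  | setNat s x e => cases h₂; exact ⟨rfl, rfl⟩
  | setReal s x e => cases h₂; exact ⟨rfl, rfl⟩
  | store s a idx e => cases h₂; exact ⟨rfl, rfl⟩
  | seq _ _ ih ih' =>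
    cases h₂ with
    | seq g g' =>
      obtain ⟨rfl, rfl⟩ := ih g
      obtain ⟨rfl, rfl⟩ := ih' g'
      exact ⟨rfl, rfl⟩
  | iteTrue hb _ ih =>
    cases h₂ with
    | iteTrue _ g => obtain ⟨rfl, rfl⟩ := ih g; exact ⟨rfl, rfl⟩
    | iteFalse hn _ => exact absurd hb hn
  | iteFalse hb _ ih =>
    cases h₂ with
    | iteTrue hn _ => exact absurd hn hb
    | iteFalse _ g => obtain ⟨rfl, rfl⟩ := ih g; exact ⟨rfl, rfl⟩
  | loopTrue hb _ _ ih ih' =>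
    cases h₂ with
    | loopTrue _ g g' =>
      obtain ⟨rfl, rfl⟩ := ih g
      obtain ⟨rfl, rfl⟩ := ih' g'
      exact ⟨rfl, rfl⟩
    | loopFalse hn => exact absurd hb hn
  | loopFalse hb =>
    cases h₂ with
    | loopTrue hn _ _ => exact absurd hn hb
    | loopFalse _ => exact ⟨rfl, rfl⟩

end RealRAM

/-! ### Smallest intersecting balls -/

namespace SIB

/-- The ball with center `z` and radius `r ≥ 0` intersects every object `Ω i`. -/
def IsIntersectingBall {n d : ℕ} (Ω : Fin n → Set (EuclideanSpace ℝ (Fin d)))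
    (z : EuclideanSpace ℝ (Fin d)) (r : ℝ) : Prop :=
  0 ≤ r ∧ ∀ i, (Metric.closedBall z r ∩ Ω i).Nonempty

/-- The optimal radius: the smallest radius of an intersecting ball. -/
noncomputable def optRadius {n d : ℕ} (Ω : Fin n → Set (EuclideanSpace ℝ (Fin d))) : ℝ :=
  sInf {r : ℝ | ∃ z, IsIntersectingBall Ω z r}

/-- The ball with center `z` and radius `r` is a `(1 + ε)`-approximate smallest intersecting
ball. -/
def IsApproxSIB {n d : ℕ} (Ω : Fin n → Set (EuclideanSpace ℝ (Fin d))) (ε : ℝ)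
    (z : EuclideanSpace ℝ (Fin d)) (r : ℝ) : Prop :=
  IsIntersectingBall Ω z r ∧ r ≤ (1 + ε) * optRadius Ω

/-- The diameter of the input: the diameter of the convex hull of all objects. -/
noncomputable def inputDiam {n d : ℕ} (Ω : Fin n → Set (EuclideanSpace ℝ (Fin d))) : ℝ :=
  Metric.diam (convexHull ℝ (⋃ i, Ω i))

/-- The Euclidean balls with centers `c i` and radii `r i`. -/
def balls {n d : ℕ} (c : Fin n → EuclideanSpace ℝ (Fin d)) (r : Fin n → ℝ) :
    Fin n → Set (EuclideanSpace ℝ (Fin d)) :=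
  fun i => Metric.closedBall (c i) (r i)

/-- `u` minimizes the linear function `hᵀ u` over `Ω`. -/
def IsLinearMinimizer {d : ℕ} (Ω : Set (EuclideanSpace ℝ (Fin d)))
    (h u : EuclideanSpace ℝ (Fin d)) : Prop :=
  u ∈ Ω ∧ ∀ v ∈ Ω, inner ℝ h u ≤ inner ℝ h v

/-- `n` vectors in `ℝᵈ` as the contents of an array, vector after vector: the coordinate `j` of the
vector `i` is in the cell `i * d + j`, and all further cells are zero. -/
def vectorsToArray {n d : ℕ} (x : Fin n → EuclideanSpace ℝ (Fin d)) : ℕ → ℝ :=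
  fun k => if hk : k < n * d then
    x (finProdFinEquiv.symm ⟨k, hk⟩).1 (finProdFinEquiv.symm ⟨k, hk⟩).2 else 0

theorem vectorsToArray_apply {n d : ℕ} (x : Fin n → EuclideanSpace ℝ (Fin d))
    (i : Fin n) (j : Fin d) : vectorsToArray x (i * d + j) = x i j := by
  have e : (i : ℕ) * d + j = (finProdFinEquiv (i, j) : Fin (n * d)) := by
    simp [finProdFinEquiv, Nat.mul_comm, Nat.add_comm]
  have hk : (i : ℕ) * d + j < n * d := e ▸ (finProdFinEquiv (i, j)).isLt
  have e' : (⟨(i : ℕ) * d + j, hk⟩ : Fin (n * d)) = finProdFinEquiv (i, j) := Fin.ext e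
  rw [vectorsToArray, dif_pos hk, e', Equiv.symm_apply_apply]

/-- `n` reals as the contents of the first `n` cells of an array; all further cells are zero. -/
def scalarsToArray {n : ℕ} (r : Fin n → ℝ) : ℕ → ℝ :=
  fun k => if hk : k < n then r ⟨k, hk⟩ else 0

/-- The vector in `ℝᵈ` in the cells `start, …, start + d - 1` of an array. -/
def vectorFromArray {d : ℕ} (A : ℕ → ℝ) (start : ℕ) : EuclideanSpace ℝ (Fin d) :=
  WithLp.toLp 2 fun j : Fin d => A (start + j)

/-- Initial memory for the smallest intersecting ball problem: the integer registers `0` and `1`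
hold `n` and `d`, the real register `0` holds `ε`, the array `0` holds the centers and the array `1`
the radii. Everything else is zero. -/
def initState {n d : ℕ} (c : Fin n → EuclideanSpace ℝ (Fin d)) (r : Fin n → ℝ) (ε : ℝ) :
    RealRAM.State where
  natReg := fun x => if x = 0 then n else if x = 1 then d else 0
  realReg := fun x => if x = 0 then ε else 0
  array := fun a => if a = 0 then vectorsToArray c else if a = 1 then scalarsToArray r
    else fun _ => 0

/-- Initial memory for the linear minimization problem: as before, with the vectors `h i` in the
array `2` and no error parameter. -/
def initStateLinear {n d : ℕ} (c : Fin n → EuclideanSpace ℝ (Fin d)) (r : Fin n → ℝ)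
    (h : Fin n → EuclideanSpace ℝ (Fin d)) : RealRAM.State where
  natReg := fun x => if x = 0 then n else if x = 1 then d else 0
  realReg := fun _ => 0
  array := fun a => if a = 0 then vectorsToArray c else if a = 1 then scalarsToArray r
    else if a = 2 then vectorsToArray h else fun _ => 0

end SIB

/-! For part 1, Cauchy–Schwarz bounds the linear function below on the ball and the closed form
attains the bound; evaluating it ball by ball gives part 2. For part 3, put f(z) = max_i (‖z − c_i‖
− r_i). If the balls have no common point, f is positive everywhere and B(z, f(z)) is the smallest
intersecting ball centred at z, so the task is to minimize the convex function f. With E = min(ε,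
1), the program moves z by the length η = E f(z)/2 towards the centre of a farthest ball and records
the best value met. Let B(w, ρ) be an intersecting ball with (1 + E)ρ below the record. Then η ≤
f(z) − ρ, and `norm_sub_smul_sub_sq_le` shows that the step lowers ‖z − w‖² by at least η². Hence ‖z
− w‖² + Σ η² never exceeds B = (f(z₀) + r₀)², a number the program can compute. Once Σ η² > B no
such w exists, and the record is at most (1 + E) r*. The test uses neither D nor r*; these enter
only the analysis: η ≥ E r*/2 and B ≤ (2D)² allow O(R²/E²) iterations of O(nd) steps each. The
invariant is `Invariant`, preserved by `runs_iteration`; `runs_sibProgram` draws the conclusion. -/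

namespace RealRAM

/-! ### Correctness rules with step bounds, and loops over coordinates -/

@[simp] theorem State.natReg_setNat (s : State) (x v y : ℕ) :
    (s.setNat x v).natReg y = if y = x then v else s.natReg y := by
  simp [State.setNat, Function.update_apply]

@[simp] theorem State.realReg_setNat (s : State) (x v : ℕ) :
    (s.setNat x v).realReg = s.realReg := rfl

@[simp] theorem State.array_setNat (s : State) (x v : ℕ) :
    (s.setNat x v).array = s.array := rfl

@[simp] theorem State.natReg_setReal (s : State) (x : ℕ) (v : ℝ) :
    (s.setReal x v).natReg = s.natReg := rfl

@[simp] theorem State.realReg_setReal (s : State) (x : ℕ) (v : ℝ) (y : ℕ) :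
    (s.setReal x v).realReg y = if y = x then v else s.realReg y := by
  simp [State.setReal, Function.update_apply]

@[simp] theorem State.array_setReal (s : State) (x : ℕ) (v : ℝ) :
    (s.setReal x v).array = s.array := rfl

@[simp] theorem State.natReg_store (s : State) (a k : ℕ) (v : ℝ) :
    (s.store a k v).natReg = s.natReg := rfl

@[simp] theorem State.realReg_store (s : State) (a k : ℕ) (v : ℝ) :
    (s.store a k v).realReg = s.realReg := rfl

theorem State.array_store_same (s : State) (a k : ℕ) (v : ℝ) (l : ℕ) :
    (s.store a k v).array a l = if l = k then v else s.array a l := by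
  simp [State.store, Function.update_apply]

theorem State.array_store_of_ne (s : State) {a b : ℕ} (k : ℕ) (v : ℝ) (h : b ≠ a) :
    (s.store a k v).array b = s.array b := by
  simp [State.store, h]

/-- `Runs p s T Q`: the program `p`, started in the state `s`, halts after at most `T` steps in a
state that satisfies `Q`. -/
def Runs (p : Cmd) (s : State) (T : ℕ) (Q : State → Prop) : Prop :=
  ∃ s' t, Exec p s s' t ∧ t ≤ T ∧ Q s'

namespace Runs

variable {p q : Cmd} {b : Test} {s : State} {T T' : ℕ} {Q Q' : State → Prop}

theorem mono (h : Runs p s T Q) (hT : T ≤ T') (hQ : ∀ s', Q s' → Q' s') : Runs p s T' Q' := by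
  obtain ⟨s', t, he, ht, hq⟩ := h
  exact ⟨s', t, he, ht.trans hT, hQ s' hq⟩

theorem skip (h : Q s) : Runs .skip s 1 Q := ⟨s, 1, .skip s, le_rfl, h⟩

theorem setNat {x : ℕ} {e : NatExpr} (h : Q (s.setNat x (e.eval s))) :
    Runs (.setNat x e) s (e.cost + 1) Q := ⟨_, _, .setNat s x e, le_rfl, h⟩

theorem setReal {x : ℕ} {e : RealExpr} (h : Q (s.setReal x (e.eval s))) :
    Runs (.setReal x e) s (e.cost + 1) Q := ⟨_, _, .setReal s x e, le_rfl, h⟩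

theorem store {a : ℕ} {idx : NatExpr} {e : RealExpr}
    (h : Q (s.store a (idx.eval s) (e.eval s))) :
    Runs (.store a idx e) s (idx.cost + e.cost + 1) Q := ⟨_, _, .store s a idx e, le_rfl, h⟩

theorem seq (h : Runs p s T fun s' => Runs q s' T' Q) : Runs (.seq p q) s (T + T') Q := by
  obtain ⟨s₁, t₁, he₁, ht₁, s₂, t₂, he₂, ht₂, hq⟩ := h
  exact ⟨s₂, t₁ + t₂, .seq he₁ he₂, by omega, hq⟩

theorem ite (hp : b.Holds s → Runs p s T Q) (hq : ¬ b.Holds s → Runs q s T Q) :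
    Runs (.ite b p q) s (b.cost + T + 1) Q := by
  by_cases h : b.Holds s
  · obtain ⟨s', t, he, ht, hQ⟩ := hp h
    exact ⟨s', _, .iteTrue h he, by omega, hQ⟩
  · obtain ⟨s', t, he, ht, hQ⟩ := hq h
    exact ⟨s', _, .iteFalse h he, by omega, hQ⟩

/-- A loop with the invariant `I k` after `k` iterations, at most `K` of which take place. -/
theorem loop (I : ℕ → State → Prop) (K : ℕ) (h₀ : I 0 s)
    (hstep : ∀ k s, I k s → b.Holds s → k < K ∧ Runs p s T (I (k + 1)))
    (hQ : ∀ k s, I k s → ¬ b.Holds s → Q s) :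
    Runs (.loop b p) s (K * (b.cost + T + 1) + (b.cost + 1)) Q := by
  -- The induction is on a bound `m` for the number of iterations left, for all intermediate states
  -- at once.
  suffices H : ∀ m k s, K - k ≤ m → I k s →
      Runs (.loop b p) s (m * (b.cost + T + 1) + (b.cost + 1)) Q from H K 0 s (by omega) h₀
  intro m
  induction m with
  | zero =>
    intro k s hm hI
    have hb : ¬ b.Holds s := fun hb => by have := (hstep k s hI hb).1; omega
    exact ⟨s, _, .loopFalse hb, by omega, hQ k s hI hb⟩
  | succ m ih =>
    intro k s hm hI
    by_cases hb : b.Holds s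
    · obtain ⟨hk, s₁, t₁, he₁, ht₁, hI₁⟩ := hstep k s hI hb
      obtain ⟨s₂, t₂, he₂, ht₂, hq⟩ := ih (k + 1) s₁ (by omega) hI₁
      exact ⟨s₂, _, .loopTrue hb he₁ he₂, by rw [Nat.succ_mul]; omega, hq⟩
    · exact ⟨s, _, .loopFalse hb, by rw [Nat.succ_mul]; omega, hQ k s hI hb⟩

end Runs

/-- `for j < d do acc := acc + e²`, with `d`, `j` and `acc` in the integer registers `1` and `2` and
the real register `5`. -/
def sumSq (e : RealExpr) : Cmd :=
  .seq (.setReal 5 (.const 0)) (.seq (.setNat 2 (.const 0))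
    (.loop (.natLt (.reg 2) (.reg 1))
      (.seq (.setReal 5 (.add (.reg 5) (.mul e e))) (.setNat 2 (.add (.reg 2) (.const 1))))))

/-- The hypothesis `he` says nothing about the real registers of `s'`, since the accumulator changes
during the loop. The term 2 * `e.cost` arises because squaring evaluates `e` twice. -/
theorem runs_sumSq {s : State} {d : ℕ} {e : RealExpr} (hd : s.natReg 1 = d) (g : ℕ → ℝ)
    (he : ∀ j < d, ∀ s' : State, (∀ x, x ≠ 2 → s'.natReg x = s.natReg x) → s'.natReg 2 = j →
      s'.array = s.array → e.eval s' = g j) :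
    Runs (sumSq e) s (d * (2 * e.cost + 13) + 8) fun s' =>
      (∀ x, x ≠ 2 → s'.natReg x = s.natReg x) ∧ (∀ x, x ≠ 5 → s'.realReg x = s.realReg x) ∧
      s'.array = s.array ∧ s'.realReg 5 = ∑ j ∈ Finset.range d, g j ^ 2 := by
  refine Runs.mono (.seq <| .setReal <| .seq <| .setNat <|
    .loop (fun j s' => j ≤ d ∧ s'.natReg 2 = j ∧
      (∀ x, x ≠ 2 → s'.natReg x = s.natReg x) ∧ (∀ x, x ≠ 5 → s'.realReg x = s.realReg x) ∧
      s'.array = s.array ∧ s'.realReg 5 = ∑ j ∈ Finset.range j, g j ^ 2) (T := 2 * e.cost + 9) d ?_ ?_ ?_)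
      ?_ fun _ h => h
  · simp +contextual [NatExpr.eval, RealExpr.eval]
  · rintro j s₁ ⟨hj, h2, hn, hr, ha, hS⟩ hb
    have hlt : j < d := by simpa [Test.Holds, NatExpr.eval, h2, hn, hd] using hb
    refine ⟨hlt, .mono (.seq <| .setReal <| .setNat ?_)
      (by simp only [RealExpr.cost, NatExpr.cost]; omega) fun _ h => h⟩
    have hej := he j hlt s₁ hn h2 ha
    simp +contextual [NatExpr.eval, RealExpr.eval, h2, hn, hr, ha, hS, hej,
      Finset.sum_range_succ, pow_two]
    omega
  · rintro j s₁ ⟨hj, h2, hn, hr, ha, hS⟩ hb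
    have hlt : ¬ j < d := by simpa [Test.Holds, NatExpr.eval, h2, hn, hd] using hb
    obtain rfl : j = d := by omega
    exact ⟨hn, hr, ha, hS⟩
  · simp only [RealExpr.cost, NatExpr.cost, Test.cost]
    ring_nf
    omega

/-- `for j < d do A[base + j] := e`, for the array `A` with the name `a`, and `d` and `j` in the
integer registers `1` and `2`. -/
def fill (a : ℕ) (base : NatExpr) (e : RealExpr) : Cmd :=
  .seq (.setNat 2 (.const 0))
    (.loop (.natLt (.reg 2) (.reg 1))
      (.seq (.store a (.add base (.reg 2)) e) (.setNat 2 (.add (.reg 2) (.const 1)))))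

/-- In `he` the cell about to be written still has its original content, so `e` may read it; this
permits updating a vector in place. -/
theorem runs_fill {s : State} {d a m : ℕ} {base : NatExpr} {e : RealExpr} (hd : s.natReg 1 = d)
    (hbase : ∀ s' : State, (∀ x, x ≠ 2 → s'.natReg x = s.natReg x) → base.eval s' = m) (g : ℕ → ℝ)
    (he : ∀ j < d, ∀ s' : State, (∀ x, x ≠ 2 → s'.natReg x = s.natReg x) → s'.natReg 2 = j →
      s'.realReg = s.realReg → (∀ b, b ≠ a → s'.array b = s.array b) →
      s'.array a (m + j) = s.array a (m + j) → e.eval s' = g j) :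
    Runs (fill a base e) s (d * (base.cost + e.cost + 11) + 6) fun s' =>
      (∀ x, x ≠ 2 → s'.natReg x = s.natReg x) ∧ s'.realReg = s.realReg ∧
      (∀ b, b ≠ a → s'.array b = s.array b) ∧
      (∀ k, k < m ∨ m + d ≤ k → s'.array a k = s.array a k) ∧
      ∀ j < d, s'.array a (m + j) = g j := by
  refine Runs.mono (.seq <| .setNat <|
    .loop (fun j s' => j ≤ d ∧ s'.natReg 2 = j ∧
      (∀ x, x ≠ 2 → s'.natReg x = s.natReg x) ∧ s'.realReg = s.realReg ∧
      (∀ b, b ≠ a → s'.array b = s.array b) ∧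
      (∀ k, k < m ∨ m + j ≤ k → s'.array a k = s.array a k) ∧
      ∀ i < j, s'.array a (m + i) = g i) (T := base.cost + e.cost + 7) d ?_ ?_ ?_)
      ?_ fun _ h => h
  · simp +contextual [NatExpr.eval]
  · rintro j s₁ ⟨hj, h2, hn, hr, ha, hf, hg⟩ hb
    have hlt : j < d := by simpa [Test.Holds, NatExpr.eval, h2, hn, hd] using hb
    refine ⟨hlt, .mono (.seq <| .store <| .setNat ?_)
      (by simp only [NatExpr.cost]; omega) fun _ h => h⟩
    have hej := he j hlt s₁ hn h2 hr ha (hf _ (by omega))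
    refine ⟨hlt, by simp [NatExpr.eval, h2], by simp +contextual [hn], by simp [hr],
      fun b hb => by simp [State.array_store_of_ne, hb, ha], fun k hk => ?_, fun i hi => ?_⟩
    · simp only [State.array_setNat, State.array_store_same, NatExpr.eval, hbase s₁ hn, h2]
      rw [if_neg (by omega), hf k (by omega)]
    · simp only [State.array_setNat, State.array_store_same, NatExpr.eval, hbase s₁ hn, h2, hej]
      rcases Nat.lt_succ_iff_lt_or_eq.mp hi with h | rfl
      · rw [if_neg (by omega), hg i h]
      · simp
  · rintro j s₁ ⟨hj, h2, hn, hr, ha, hf, hg⟩ hb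
    have hlt : ¬ j < d := by simpa [Test.Holds, NatExpr.eval, h2, hn, hd] using hb
    obtain rfl : j = d := by omega
    exact ⟨hn, hr, ha, hf, hg⟩
  · simp only [NatExpr.cost, Test.cost]
    ring_nf
    omega

end RealRAM

/-! ### Geometry of balls, the optimal radius and the diameter -/

namespace SIB

open Metric

/-- Cauchy–Schwarz gives ⟨h, c − v⟩ ≤ ‖h‖ r on the ball, with equality at the stated point. For h =
0 the convention r / 0 = 0 makes that point the centre, which is also what the machine computes. -/
theorem isLinearMinimizer_closedBall {d : ℕ} (c h : EuclideanSpace ℝ (Fin d)) {r : ℝ} (hr : 0 ≤ r) :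
    IsLinearMinimizer (closedBall c r) h (c - (r / ‖h‖) • h) := by
  rcases eq_or_ne h 0 with rfl | hh
  · exact ⟨by simpa using hr, by simp⟩
  have hpos : 0 < ‖h‖ := norm_pos_iff.mpr hh
  refine ⟨?_, fun v hv => ?_⟩
  · rw [mem_closedBall, dist_eq_norm, sub_sub_cancel_left, norm_neg, norm_smul, norm_div, norm_norm,
      Real.norm_of_nonneg hr, div_mul_cancel₀ _ hpos.ne']
  · have h1 : inner ℝ h (c - v) ≤ ‖h‖ * r :=
      (real_inner_le_norm _ _).trans (mul_le_mul_of_nonneg_left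
        (by rw [← dist_eq_norm, dist_comm]; exact hv) hpos.le)
    have h2 : r / ‖h‖ * ‖h‖ ^ 2 = ‖h‖ * r := by field_simp
    rw [inner_sub_right] at h1 ⊢
    rw [inner_smul_right, real_inner_self_eq_norm_sq, h2]
    linarith

variable {n d : ℕ} {c : Fin n → EuclideanSpace ℝ (Fin d)} {r : Fin n → ℝ}

theorem isIntersectingBall_balls_iff (hr : ∀ i, 0 ≤ r i) {z : EuclideanSpace ℝ (Fin d)} {ρ : ℝ} :
    IsIntersectingBall (balls c r) z ρ ↔ 0 ≤ ρ ∧ ∀ i, ‖z - c i‖ ≤ ρ + r i := by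
  refine and_congr_right fun hρ => forall_congr' fun i => ?_
  rw [balls, ← Set.not_disjoint_iff_nonempty_inter, disjoint_closedBall_closedBall_iff hρ (hr i),
    not_lt, dist_eq_norm]

theorem optRadius_nonneg (Ω : Fin n → Set (EuclideanSpace ℝ (Fin d))) : 0 ≤ optRadius Ω :=
  Real.sInf_nonneg fun _ ⟨_, h⟩ => h.1

theorem optRadius_le {Ω : Fin n → Set (EuclideanSpace ℝ (Fin d))} {z : EuclideanSpace ℝ (Fin d)}
    {ρ : ℝ} (h : IsIntersectingBall Ω z ρ) : optRadius Ω ≤ ρ :=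
  csInf_le ⟨0, fun _ ⟨_, h⟩ => h.1⟩ ⟨z, h⟩

theorem exists_isIntersectingBall (hr : ∀ i, 0 ≤ r i) :
    ∃ z ρ, IsIntersectingBall (balls c r) z ρ := by
  refine ⟨0, ∑ i, ‖c i‖, (isIntersectingBall_balls_iff hr).2 ⟨by positivity, fun i => ?_⟩⟩
  have := Finset.single_le_sum (f := fun i => ‖c i‖) (fun i _ => norm_nonneg _) (Finset.mem_univ i)
  have := hr i
  simp only [zero_sub, norm_neg]
  linarith

/-- Nearly optimal balls take the place of an optimal one, so attainment of the infimum is never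
needed. -/
theorem exists_isIntersectingBall_lt (hr : ∀ i, 0 ≤ r i) {x : ℝ}
    (hx : optRadius (balls c r) < x) : ∃ z ρ, IsIntersectingBall (balls c r) z ρ ∧ ρ < x := by
  obtain ⟨z, ρ, h⟩ := exists_isIntersectingBall (c := c) hr
  obtain ⟨ρ', ⟨z', h'⟩, hlt⟩ :=
    exists_lt_of_csInf_lt (s := {ρ | ∃ z, IsIntersectingBall (balls c r) z ρ}) ⟨ρ, z, h⟩ hx
  exact ⟨z', ρ', h', hlt⟩

theorem exists_pos_of_iInter_eq_empty (hΩ : (⋂ i, balls c r i) = ∅)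
    (z : EuclideanSpace ℝ (Fin d)) : ∃ i, 0 < ‖z - c i‖ - r i := by
  by_contra! h
  refine Set.notMem_empty z (hΩ ▸ Set.mem_iInter.2 fun i => ?_)
  rw [balls, mem_closedBall, dist_eq_norm]
  linarith [h i]

theorem two_le_of_iInter_eq_empty (hr : ∀ i, 0 ≤ r i) (hΩ : (⋂ i, balls c r i) = ∅) : 2 ≤ n := by
  by_contra! hn
  obtain rfl | rfl : n = 0 ∨ n = 1 := by omega
  · obtain ⟨i, -⟩ := exists_pos_of_iInter_eq_empty hΩ 0
    exact i.elim0
  · obtain ⟨i, hi⟩ := exists_pos_of_iInter_eq_empty hΩ (c 0)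
    rw [Subsingleton.elim i 0, sub_self, norm_zero] at hi
    linarith [hr 0]

theorem dim_pos_of_iInter_eq_empty (hr : ∀ i, 0 ≤ r i) (hΩ : (⋂ i, balls c r i) = ∅) : 1 ≤ d := by
  by_contra! hd
  obtain rfl : d = 0 := by omega
  obtain ⟨i, hi⟩ := exists_pos_of_iInter_eq_empty hΩ 0
  rw [Subsingleton.elim (0 - c i) 0, norm_zero] at hi
  linarith [hr i]

/-- Compactness: if r* = 0, the intersections of the balls enlarged by 1/(m + 1) are nonempty,
nested and compact, so they share a point, which then lies in every original ball. -/
theorem optRadius_pos (hr : ∀ i, 0 ≤ r i) (hΩ : (⋂ i, balls c r i) = ∅) :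
    0 < optRadius (balls c r) := by
  refine (optRadius_nonneg _).lt_of_ne' fun h0 => ?_
  let t : ℕ → Set (EuclideanSpace ℝ (Fin d)) :=
    fun m => ⋂ i, closedBall (c i) (1 / ((m : ℝ) + 1) + r i)
  have hn := two_le_of_iInter_eq_empty hr hΩ
  have hclosed : ∀ m, IsClosed (t m) := fun m => isClosed_iInter fun i => isClosed_closedBall
  obtain ⟨z, hz⟩ : (⋂ m, t m).Nonempty := by
    refine IsCompact.nonempty_iInter_of_sequence_nonempty_isCompact_isClosed t (fun m => ?_)
      (fun m => ?_) ?_ hclosed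
    · refine Set.iInter_mono fun i => closedBall_subset_closedBall ?_
      have := Nat.one_div_le_one_div (α := ℝ) (Nat.le_succ m)
      push_cast at this ⊢
      linarith
    · obtain ⟨z, ρ, h, hlt⟩ := exists_isIntersectingBall_lt (c := c) (x := 1 / ((m : ℝ) + 1)) hr
        (by rw [h0]; positivity)
      refine ⟨z, Set.mem_iInter.2 fun i => ?_⟩
      rw [mem_closedBall, dist_eq_norm]
      linarith [((isIntersectingBall_balls_iff hr).1 h).2 i]
    · exact (isCompact_closedBall _ _).of_isClosed_subset (hclosed 0)
        (Set.iInter_subset _ (⟨0, by omega⟩ : Fin n))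
  obtain ⟨i, hi⟩ := exists_pos_of_iInter_eq_empty hΩ z
  obtain ⟨m, hm⟩ := exists_nat_one_div_lt hi
  have := Set.mem_iInter.1 (Set.mem_iInter.1 hz m) i
  rw [mem_closedBall, dist_eq_norm] at this
  linarith

theorem inputDiam_balls : inputDiam (balls c r) = diam (⋃ i, balls c r i) := convexHull_diam _

theorem isBounded_iUnion_balls : Bornology.IsBounded (⋃ i, balls c r i) :=
  Bornology.isBounded_iUnion.2 fun _ => isBounded_closedBall

theorem norm_sub_le_inputDiam (hr : ∀ i, 0 ≤ r i) (i j : Fin n) :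
    ‖c i - c j‖ ≤ inputDiam (balls c r) := by
  rw [inputDiam_balls, ← dist_eq_norm]
  exact dist_le_diam_of_mem isBounded_iUnion_balls
    (Set.mem_iUnion.2 ⟨i, mem_closedBall_self (hr i)⟩)
    (Set.mem_iUnion.2 ⟨j, mem_closedBall_self (hr j)⟩)

/-- A ball has diameter twice its radius only in positive dimension, whence `hd`. -/
theorem radius_le_inputDiam (hd : 1 ≤ d) (hr : ∀ i, 0 ≤ r i) (i : Fin n) :
    r i ≤ inputDiam (balls c r) := by
  have : NeZero d := ⟨by omega⟩
  rw [inputDiam_balls]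
  have h1 : diam (balls c r i) = 2 * r i := Metric.diam_closedBall_eq _ (hr i)
  have h2 : diam (balls c r i) ≤ diam (⋃ i, balls c r i) :=
    diam_mono (Set.subset_iUnion _ i) isBounded_iUnion_balls
  linarith [hr i]

/-- A step of length `η` from `z` towards the center `a` approaches every point `w` that is closer
to `a` than `z` is. -/
theorem norm_sub_smul_sub_sq_le {E : Type*} [NormedAddCommGroup E] [InnerProductSpace ℝ E]
    {z a w : E} {η δ : ℝ} (hη : 0 ≤ η) (hz : 0 < ‖z - a‖) (hw : ‖w - a‖ ≤ ‖z - a‖ - δ) :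
    ‖z - (η / ‖z - a‖) • (z - a) - w‖ ^ 2 ≤ ‖z - w‖ ^ 2 - 2 * η * δ + η ^ 2 := by
  set N := ‖z - a‖
  have e1 : z - (η / N) • (z - a) - w = (z - w) - (η / N) • (z - a) := by abel
  have e2 : inner ℝ (z - w) (z - a) = N ^ 2 - inner ℝ (w - a) (z - a) := by
    rw [← real_inner_self_eq_norm_sq, ← inner_sub_left]
    congr 1
    abel
  have e3 : inner ℝ (w - a) (z - a) ≤ (N - δ) * N :=
    (real_inner_le_norm _ _).trans (mul_le_mul_of_nonneg_right hw hz.le)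
  have e4 : ‖(η / N) • (z - a)‖ = η := by
    rw [norm_smul, norm_div, Real.norm_of_nonneg hη, Real.norm_of_nonneg hz.le,
      div_mul_cancel₀ _ hz.ne']
  -- Cauchy–Schwarz in `e3` yields ⟨z − w, z − a⟩ ≥ δ N: the subgradient inequality for the distance
  -- to a.
  have e5 : η * δ ≤ η / N * inner ℝ (z - w) (z - a) := by
    rw [e2, div_mul_eq_mul_div, le_div_iff₀ hz]
    nlinarith [mul_le_mul_of_nonneg_left e3 hη]
  rw [e1, norm_sub_sq_real, inner_smul_right, e4]
  linarith

theorem scalarsToArray_apply (r : Fin n → ℝ) (i : Fin n) : scalarsToArray r i = r i := by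
  simp [scalarsToArray]

theorem vectorFromArray_apply (A : ℕ → ℝ) (k : ℕ) (j : Fin d) :
    (vectorFromArray A k : EuclideanSpace ℝ (Fin d)) j = A (k + j) := rfl

theorem norm_eq_sqrt_sum_range (x : EuclideanSpace ℝ (Fin d)) {g : ℕ → ℝ}
    (hg : ∀ j : Fin d, g j = x j) : ‖x‖ = Real.sqrt (∑ j ∈ Finset.range d, g j ^ 2) := by
  rw [EuclideanSpace.norm_eq, Finset.sum_range]
  simp [hg]

end SIB

/-! ### Loops over the balls: linear minimization and the farthest ball -/

namespace SIB

open RealRAM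

/-- The loop `for i < n do p`, where `i` is in the integer register `3` and the offset `i * d` in
the integer register `4`. -/
def forEach (p : Cmd) : Cmd :=
  .seq (.setNat 3 (.const 0)) (.seq (.setNat 4 (.const 0))
    (.loop (.natLt (.reg 3) (.reg 0))
      (.seq p (.seq (.setNat 4 (.add (.reg 4) (.reg 1))) (.setNat 3 (.add (.reg 3) (.const 1)))))))

/-- By `hI` the invariant ignores the loop counters in the registers 2 to 4. The body may change
only the integer registers 2, the inner counter, and 5, the output of `farthest`. -/
theorem runs_forEach {p : Cmd} {s : State} {n d T : ℕ} (hn : s.natReg 0 = n) (hd : s.natReg 1 = d)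
    (I : ℕ → State → Prop)
    (hI : ∀ k s₁ x v, 2 ≤ x → x ≤ 4 → I k s₁ → I k (s₁.setNat x v)) (h₀ : I 0 s)
    (hstep : ∀ (k : Fin n) s₁, s₁.natReg 0 = n → s₁.natReg 1 = d → s₁.natReg 3 = (k : ℕ) →
      s₁.natReg 4 = (k : ℕ) * d → I (k : ℕ) s₁ →
      Runs p s₁ T fun s₂ => (∀ x, x ≠ 2 → x ≠ 5 → s₂.natReg x = s₁.natReg x) ∧ I (k + 1) s₂) :
    Runs (forEach p) s (n * (T + 12) + 8) fun s' =>
      s'.natReg 0 = n ∧ s'.natReg 1 = d ∧ I n s' := by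
  refine Runs.mono (.seq <| .setNat <| .seq <| .setNat <|
    .loop (fun k s' => k ≤ n ∧ s'.natReg 0 = n ∧ s'.natReg 1 = d ∧ s'.natReg 3 = k ∧
      s'.natReg 4 = k * d ∧ I k s') (T := T + 8) n ?_ ?_ ?_) ?_ fun _ h => h
  · have := hI _ _ 4 0 (by norm_num) (by norm_num) (hI _ _ 3 0 (by norm_num) (by norm_num) h₀)
    simpa [NatExpr.eval, hn, hd] using this
  · rintro k s₁ ⟨hk, h0, h1, h3, h4, hs₁⟩ hb
    have hlt : k < n := by simpa [Test.Holds, NatExpr.eval, h3, h0] using hb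
    refine ⟨hlt, .mono (.seq <| (hstep ⟨k, hlt⟩ s₁ h0 h1 h3 h4 hs₁).mono le_rfl ?_)
      (T := T + ((4 : ℕ) + 4)) (by omega) fun _ h => h⟩
    rintro s₂ ⟨hx, hs₂⟩
    refine .seq (.setNat (.setNat ⟨hlt, ?_, ?_, ?_, ?_, ?_⟩))
    · simp [hx, h0]
    · simp [hx, h1]
    · simp [NatExpr.eval, hx, h3]
    · simp [NatExpr.eval, hx, h4, h1, Nat.succ_mul]
    · exact hI _ _ 3 _ (by norm_num) (by norm_num) (hI _ _ 4 _ (by norm_num) (by norm_num) hs₂)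
  · rintro k s₁ ⟨hk, h0, h1, h3, h4, hs₁⟩ hb
    have hlt : ¬ k < n := by simpa [Test.Holds, NatExpr.eval, h3, h0] using hb
    obtain rfl : k = n := by omega
    exact ⟨h0, h1, hs₁⟩
  · simp only [NatExpr.cost, Test.cost]
    ring_nf
    omega

/-- The program that minimizes the linear functions with the coefficients in the array `2` over the
balls. -/
def linearProgram : Cmd :=
  forEach (.seq (sumSq (.load 2 (.add (.reg 4) (.reg 2))))
    (fill 3 (.reg 4) (.sub (.load 0 (.add (.reg 4) (.reg 2)))
      (.mul (.div (.load 1 (.reg 3)) (.sqrt (.reg 5))) (.load 2 (.add (.reg 4) (.reg 2)))))))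

variable {n d : ℕ} {c h : Fin n → EuclideanSpace ℝ (Fin d)} {r : Fin n → ℝ}

theorem runs_linearProgram :
    Runs linearProgram (initStateLinear c r h) (n * (d * 48 + 26) + 8) fun s =>
      ∀ i : Fin n, vectorFromArray (s.array 3) (i * d) = c i - (r i / ‖h i‖) • h i := by
  refine (runs_forEach (n := n) (d := d) (T := d * 48 + 14) rfl rfl
    (fun k s => s.array 0 = vectorsToArray c ∧ s.array 1 = scalarsToArray r ∧
      s.array 2 = vectorsToArray h ∧
      ∀ i : Fin n, i < k → vectorFromArray (s.array 3) (i * d) = c i - (r i / ‖h i‖) • h i)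
    (fun k s₁ x v _ _ hs => hs) ?_ ?_).mono le_rfl fun s' hs' i => hs'.2.2.2.2.2 i i.2
  · simp [initStateLinear]
  rintro k s₁ h0 h1 h3 h4 ⟨a0, a1, a2, hu⟩
  refine .mono (.seq <| (runs_sumSq h1 (fun j => vectorsToArray h (k * d + j)) ?_).mono le_rfl ?_)
    (T := d * 21 + 8 + (d * 27 + 6)) (by omega) fun _ h => h
  · intro j _ s' hx h2 ha
    simp [RealExpr.eval, NatExpr.eval, hx, h2, h4, ha, a2]
  rintro s₂ ⟨hx, -, ha, hN⟩
  have hN' : Real.sqrt (s₂.realReg 5) = ‖h k‖ := by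
    rw [hN, norm_eq_sqrt_sum_range (h k) (g := fun j => vectorsToArray h (k * d + j))
      (vectorsToArray_apply h k)]
  refine (runs_fill (m := k * d) (d := d) (by simp [hx, h1])
    (by intro s' hs'; simp [NatExpr.eval, hs', hx, h4])
    (fun j => vectorsToArray c (k * d + j) - r k / ‖h k‖ * vectorsToArray h (k * d + j)) ?_).mono
    (by simp [NatExpr.cost, RealExpr.cost]) ?_
  · intro j _ s' hx' h2 hr' ha' _
    simp [RealExpr.eval, NatExpr.eval, hx', hx, h2, h3, h4, hr', hN', ha', ha, a0, a1, a2,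
      scalarsToArray_apply]
  rintro s₃ ⟨hx', -, ha', hold, hnew⟩
  refine ⟨fun x hx2 _ => by rw [hx' x hx2, hx x hx2], by simp [ha', ha, a0], by simp [ha', ha, a1],
    by simp [ha', ha, a2], fun i hi => ?_⟩
  rcases Nat.lt_succ_iff_lt_or_eq.mp hi with hlt | heq
  -- An earlier vector ends before the cell k * d and is left untouched.
  · rw [← hu i hlt]
    ext j
    rw [vectorFromArray_apply, vectorFromArray_apply, hold, ha]
    have := Nat.mul_le_mul_right d hlt
    rw [Nat.succ_mul] at this
    have := j.2
    omega
  · obtain rfl : i = k := Fin.ext heq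
    ext j
    rw [vectorFromArray_apply, hnew j j.2, vectorsToArray_apply, vectorsToArray_apply]
    rfl

/-- The program that finds the ball farthest from the point `z` in the array `3`. The integer
register `5` gets the offset of its center, the real register `7` the distance from `z` to its
center, and the real register `6` the distance from `z` to the ball. -/
def farthest : Cmd :=
  .seq (.setReal 6 (.const 0)) (forEach
    (.seq (sumSq (.sub (.load 3 (.reg 2)) (.load 0 (.add (.reg 4) (.reg 2)))))
      (.seq (.setReal 5 (.sqrt (.reg 5)))
        (.ite (.realLt (.reg 6) (.sub (.reg 5) (.load 1 (.reg 3))))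
          (.seq (.setReal 6 (.sub (.reg 5) (.load 1 (.reg 3))))
            (.seq (.setReal 7 (.reg 5)) (.setNat 5 (.reg 4))))
          .skip))))

/-- The registers describe the ball farthest from the point in the array `3`. -/
def IsFarthest (c : Fin n → EuclideanSpace ℝ (Fin d)) (r : Fin n → ℝ) (s : State) : Prop :=
  ∃ i : Fin n, s.natReg 5 = i * d ∧ s.realReg 7 = ‖vectorFromArray (s.array 3) 0 - c i‖ ∧
    s.realReg 6 = ‖vectorFromArray (s.array 3) 0 - c i‖ - r i ∧
    ∀ j, ‖vectorFromArray (s.array 3) 0 - c j‖ - r j ≤ s.realReg 6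

/-- The memory holds the input. -/
def HoldsInput (c : Fin n → EuclideanSpace ℝ (Fin d)) (r : Fin n → ℝ) (s : State) : Prop :=
  s.natReg 0 = n ∧ s.natReg 1 = d ∧ s.array 0 = vectorsToArray c ∧ s.array 1 = scalarsToArray r

theorem runs_farthest (hΩ : (⋂ i, balls c r i) = ∅) {s : State} (hs : HoldsInput c r s) :
    Runs farthest s (n * (d * 27 + 44) + 10) fun s' =>
      HoldsInput c r s' ∧ s'.array = s.array ∧
      (∀ x, x ≠ 5 → x ≠ 6 → x ≠ 7 → s'.realReg x = s.realReg x) ∧ IsFarthest c r s' := by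
  obtain ⟨h0, h1, a0, a1⟩ := hs
  set z : EuclideanSpace ℝ (Fin d) := vectorFromArray (s.array 3) 0 with hz
  refine .mono (.seq <| .setReal <| (runs_forEach (n := n) (d := d) (T := d * 27 + 32)
    (by exact h0) (by exact h1)
    (fun k s' => s'.array = s.array ∧
      (∀ x, x ≠ 5 → x ≠ 6 → x ≠ 7 → s'.realReg x = s.realReg x) ∧ 0 ≤ s'.realReg 6 ∧
      (∀ j : Fin n, j < k → ‖z - c j‖ - r j ≤ s'.realReg 6) ∧
      -- The running maximum starts at 0, so the registers describe a ball only once it is positive.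
      (0 < s'.realReg 6 → ∃ i : Fin n, s'.natReg 5 = i * d ∧ s'.realReg 7 = ‖z - c i‖ ∧
        s'.realReg 6 = ‖z - c i‖ - r i)) ?_ ?_ ?_).mono le_rfl ?_) ?_ fun _ h => h
  · rintro k s₁ x v h2 h4 ⟨ha, hr, hF, hle, hex⟩
    refine ⟨ha, hr, hF, hle, fun h => ?_⟩
    simpa [show 5 ≠ x by omega] using hex h
  · simp +contextual [RealExpr.eval]
  · rintro k s₁ h0 h1 h3 h4 ⟨ha, hr, hF, hle, hex⟩
    refine .mono (.seq <| (runs_sumSq h1 (fun j => s.array 3 j - vectorsToArray c (k * d + j))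
      ?_).mono le_rfl ?_) (T := d * 27 + 8 + (3 + 21)) (by omega) fun _ h => h
    · intro j _ s' hx' h2 ha'
      simp [RealExpr.eval, NatExpr.eval, hx', h2, h4, ha', ha, a0]
    rintro s₂ ⟨hx₂, hr₂, ha₂, hN⟩
    have hN' : Real.sqrt (s₂.realReg 5) = ‖z - c k‖ := by
      rw [hN, norm_eq_sqrt_sum_range (z - c k)]
      intro j
      simp [vectorsToArray_apply, hz, vectorFromArray_apply]
    refine .seq <| .setReal <| .mono (.ite (T := 12) (fun hb => ?_) fun hb => ?_)
      (by simp [Test.cost, RealExpr.cost, NatExpr.cost]) fun _ h => h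
    · have hlt : s₁.realReg 6 < ‖z - c k‖ - r k := by
        simpa [Test.Holds, RealExpr.eval, NatExpr.eval, hN', hr₂, hx₂, h3, ha₂, ha, a1,
          scalarsToArray_apply] using hb
      refine .mono (.seq <| .setReal <| .seq <| .setReal <| .setNat ?_)
        (by simp [RealExpr.cost, NatExpr.cost]) fun _ h => h
      have h6 : (s₂.realReg 5).sqrt - scalarsToArray r k = ‖z - c k‖ - r k := by
        rw [hN', scalarsToArray_apply]
      refine ⟨?_, ?_, ?_, ?_, ?_, ?_⟩
      · simp +contextual [hx₂]
      · simp [ha₂, ha]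
      · simp +contextual [hr₂, hr]
      · simp [RealExpr.eval, NatExpr.eval, hx₂, h3, ha₂, ha, a1, h6]
        linarith
      · intro j hj
        simp [RealExpr.eval, NatExpr.eval, hx₂, h3, ha₂, ha, a1, h6]
        rcases Nat.lt_succ_iff_lt_or_eq.mp hj with h | h
        · linarith [hle j h]
        · obtain rfl : j = k := Fin.ext h
          linarith
      · intro _
        refine ⟨k, ?_, ?_, ?_⟩
        · simp [NatExpr.eval, hx₂, h4]
        · simp [RealExpr.eval, hN']
        · simp [RealExpr.eval, NatExpr.eval, hx₂, h3, ha₂, ha, a1, h6]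
    · have hnlt : ¬ s₁.realReg 6 < ‖z - c k‖ - r k := by
        simpa [Test.Holds, RealExpr.eval, NatExpr.eval, hN', hr₂, hx₂, h3, ha₂, ha, a1,
          scalarsToArray_apply] using hb
      refine Runs.mono (.skip ?_) (by norm_num) fun _ h => h
      refine ⟨?_, ?_, ?_, ?_, ?_, ?_⟩
      · simp +contextual [hx₂]
      · simp [ha₂, ha]
      · simp +contextual [hr₂, hr]
      · simpa [hr₂] using hF
      · intro j hj
        simp [hr₂]
        rcases Nat.lt_succ_iff_lt_or_eq.mp hj with h | h
        · linarith [hle j h]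
        · obtain rfl : j = k := Fin.ext h
          linarith
      · simpa [hr₂, hx₂] using hex
  · rintro s' ⟨h0', h1', ha, hr, hF, hle, hex⟩
    -- The empty intersection makes the final maximum positive, so some ball has been stored.
    obtain ⟨i, hi⟩ := exists_pos_of_iInter_eq_empty hΩ z
    obtain ⟨k, hk5, hk7, hk6⟩ := hex (hi.trans_le (hle i i.2))
    refine ⟨⟨h0', h1', by rw [ha, a0], by rw [ha, a1]⟩, ha, hr, k, hk5, ?_⟩
    rw [ha]
    exact ⟨hk7, hk6, fun j => hle j j.2⟩
  · simp only [RealExpr.cost]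
    ring_nf
    omega

end SIB

/-! ### The subgradient method -/

namespace SIB

open RealRAM

/-- The step from the point in the array `3` towards the farthest ball. The real registers `2`, `3`
and `8` hold `min ε 1`, the sum of the squares of the step lengths and the step length. -/
def step : Cmd :=
  .seq (.setReal 8 (.div (.mul (.reg 2) (.reg 6)) (.const 2)))
    (.seq (.setReal 3 (.add (.reg 3) (.mul (.reg 8) (.reg 8))))
      (fill 3 (.const 0) (.sub (.load 3 (.reg 2)) (.mul (.div (.reg 8) (.reg 7))
        (.sub (.load 3 (.reg 2)) (.load 0 (.add (.reg 5) (.reg 2))))))))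

/-- Record the current point and its objective value. -/
def record : Cmd :=
  .seq (.setReal 1 (.reg 6)) (fill 2 (.const 0) (.load 3 (.reg 2)))

/-- Start at the first center, with `(f + r₀)²` in the real register `4`, where `f` is the objective
value there. -/
def setup : Cmd :=
  .seq (.ite (.realLt (.reg 0) (.const 1)) (.setReal 2 (.reg 0)) (.setReal 2 (.const 1)))
    (.seq (fill 3 (.const 0) (.load 0 (.reg 2)))
      (.seq farthest
        (.seq record
          (.seq (.setReal 3 (.const 0))
            (.setReal 4 (.mul (.add (.reg 6) (.load 1 (.const 0)))
              (.add (.reg 6) (.load 1 (.const 0)))))))))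

/-- One iteration of the subgradient method. -/
def iteration : Cmd :=
  .seq step (.seq farthest (.ite (.realLt (.reg 6) (.reg 1)) record .skip))

/-- The subgradient method for the largest distance to a ball, with steps proportional to the
objective value. -/
def sibProgram : Cmd :=
  .seq setup (.loop (.not (.realLt (.reg 4) (.reg 3))) iteration)

variable {n d : ℕ} {c : Fin n → EuclideanSpace ℝ (Fin d)} {r : Fin n → ℝ} {ε : ℝ} {s : State}

theorem runs_step {i : Fin n} (hs : HoldsInput c r s) (h5 : s.natReg 5 = i * d) :
    Runs step s (d * 27 + 20) fun s' => HoldsInput c r s' ∧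
      s'.realReg 1 = s.realReg 1 ∧ s'.realReg 2 = s.realReg 2 ∧ s'.realReg 4 = s.realReg 4 ∧
      s'.realReg 3 = s.realReg 3 + (s.realReg 2 * s.realReg 6 / 2) ^ 2 ∧
      s'.array 2 = s.array 2 ∧
      (vectorFromArray (s'.array 3) 0 : EuclideanSpace ℝ (Fin d)) = vectorFromArray (s.array 3) 0 -
        (s.realReg 2 * s.realReg 6 / 2 / s.realReg 7) • (vectorFromArray (s.array 3) 0 - c i) := by
  obtain ⟨h0, h1, a0, a1⟩ := hs
  set η := s.realReg 2 * s.realReg 6 / 2 with hη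
  refine .mono (.seq <| .setReal <| .seq <| .setReal <|
    (runs_fill (m := 0) (d := d) (by exact h1) (by intro s' _; rfl)
      (fun j => s.array 3 j - η / s.realReg 7 * (s.array 3 j - vectorsToArray c (i * d + j)))
      ?_).mono le_rfl ?_) ?_ fun _ h => h
  · intro j _ s' hx h2 hr ha h3
    -- `h3` is the unchanged content of the cell being overwritten: the point moves in place.
    rw [zero_add] at h3
    simp [RealExpr.eval, NatExpr.eval, hx, h2, h5, hr, ha, h3, a0, hη]
  · rintro s' ⟨hx, hr, ha, -, hnew⟩
    refine ⟨⟨by simp [hx, h0], by simp [hx, h1], by simp [ha, a0], by simp [ha, a1]⟩,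
      by simp [hr], by simp [hr], by simp [hr], ?_, by simp [ha], ?_⟩
    · simp [hr, RealExpr.eval, hη, pow_two]
    · ext j
      rw [vectorFromArray_apply, hnew j j.2, vectorsToArray_apply]
      simp [vectorFromArray_apply]
  · simp only [RealExpr.cost, NatExpr.cost]
    ring_nf
    omega

theorem runs_record (h1 : s.natReg 1 = d) :
    Runs record s (d * 14 + 8) fun s' => (∀ x, x ≠ 2 → s'.natReg x = s.natReg x) ∧
      (∀ x, x ≠ 1 → s'.realReg x = s.realReg x) ∧ s'.realReg 1 = s.realReg 6 ∧
      (∀ b, b ≠ 2 → s'.array b = s.array b) ∧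
      (vectorFromArray (s'.array 2) 0 : EuclideanSpace ℝ (Fin d)) =
        vectorFromArray (s.array 3) 0 := by
  refine .mono (.seq <| .setReal <|
    (runs_fill (m := 0) (d := d) (by exact h1) (by intro s' _; rfl)
      (fun j => s.array 3 j) ?_).mono le_rfl ?_) ?_ fun _ h => h
  · intro j _ s' hx h2 hr ha h3
    simp [RealExpr.eval, NatExpr.eval, h2, ha]
  · rintro s' ⟨hx, hr, ha, -, hnew⟩
    refine ⟨fun x h => by simp [hx x h], fun x h => by simp [hr, h], by simp [hr, RealExpr.eval],
      fun b h => by simp [ha b h], ?_⟩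
    ext j
    rw [vectorFromArray_apply, hnew j j.2, vectorFromArray_apply, zero_add]
  · simp only [RealExpr.cost, NatExpr.cost]
    ring_nf
    omega

/-- The state after `k` iterations: every point `w` that is much better than the recorded one has
come closer. -/
structure Invariant (c : Fin n → EuclideanSpace ℝ (Fin d)) (r : Fin n → ℝ) (ε B : ℝ) (k : ℕ)
    (s : State) : Prop where
  input : HoldsInput c r s
  reg_two : s.realReg 2 = min ε 1
  reg_four : s.realReg 4 = B
  isFarthest : IsFarthest c r s
  best_le : s.realReg 1 ≤ s.realReg 6
  isIntersectingBall : IsIntersectingBall (balls c r) (vectorFromArray (s.array 2) 0) (s.realReg 1)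
  le_sum : k * (min ε 1 * optRadius (balls c r) / 2) ^ 2 ≤ s.realReg 3
  approach : ∀ w ρ, IsIntersectingBall (balls c r) w ρ → (1 + min ε 1) * ρ < s.realReg 1 →
    ‖vectorFromArray (s.array 3) 0 - w‖ ^ 2 + s.realReg 3 ≤ B

theorem IsFarthest.isIntersectingBall (hr : ∀ i, 0 ≤ r i) (hΩ : (⋂ i, balls c r i) = ∅)
    (hs : IsFarthest c r s) :
    IsIntersectingBall (balls c r) (vectorFromArray (s.array 3) 0) (s.realReg 6) := by
  obtain ⟨-, -, -, -, hle⟩ := hs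
  obtain ⟨j, hj⟩ := exists_pos_of_iInter_eq_empty hΩ (vectorFromArray (s.array 3) 0)
  exact (isIntersectingBall_balls_iff hr).2
    ⟨(hj.trans_le (hle j)).le, fun i => by linarith [hle i]⟩

/-- The witness is B = (f(c₀) + r₀)². If ρ ≤ f(c₀), then ‖c₀ − w‖ ≤ ρ + r₀ ≤ f(c₀) + r₀; and both
f(c₀) and r₀ are at most D. -/
theorem runs_setup (hr : ∀ i, 0 ≤ r i) (hΩ : (⋂ i, balls c r i) = ∅) (hε : 0 < ε) :
    Runs setup (initState c r ε) (n * (d * 27 + 44) + d * 28 + 45) fun s => ∃ B,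
      B ≤ (2 * inputDiam (balls c r)) ^ 2 ∧ Invariant c r ε B 0 s := by
  have hn := two_le_of_iInter_eq_empty hr hΩ
  have hd := dim_pos_of_iInter_eq_empty hr hΩ
  have hin : HoldsInput c r (initState c r ε) := ⟨rfl, rfl, rfl, rfl⟩
  let i₀ : Fin n := ⟨0, by omega⟩
  refine .mono (.seq <| (Runs.ite (T := 2) (Q := fun s => HoldsInput c r s ∧ s.realReg 2 = min ε 1)
    (fun hb => .setReal ?_) (fun hb => .setReal ?_)).mono le_rfl ?_)
    (T := 6 + (d * 14 + 6 + (n * (d * 27 + 44) + 10 + (d * 14 + 8 + (2 + 10)))))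
    (by omega) fun _ h => h
  · have hlt : ε < 1 := by
      simpa [Test.Holds, RealExpr.eval, initState] using hb
    exact ⟨hin, by simp [RealExpr.eval, initState, hlt.le]⟩
  · have hlt : ¬ ε < 1 := by
      simpa [Test.Holds, RealExpr.eval, initState] using hb
    exact ⟨hin, by simp [RealExpr.eval, not_lt.1 hlt]⟩
  rintro s₁ ⟨⟨h0, h1, a0, a1⟩, hE⟩
  refine .seq <| (runs_fill (m := 0) (d := d) h1 (by intro s' _; rfl) (fun j => vectorsToArray c j)
      ?_).mono (by simp [RealExpr.cost, NatExpr.cost]) ?_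
  · intro j _ s' hx h2 hr ha h3
    simp [RealExpr.eval, NatExpr.eval, h2, ha, a0]
  rintro s₂ ⟨hx₂, hr₂, ha₂, -, hnew⟩
  have hz : vectorFromArray (s₂.array 3) 0 = c i₀ := by
    ext j
    rw [vectorFromArray_apply, hnew j j.2, ← vectorsToArray_apply]
    simp [i₀]
  refine .seq <| (runs_farthest hΩ (c := c) (r := r) ⟨by simp [hx₂, h0], by simp [hx₂, h1],
    by simp [ha₂, a0], by simp [ha₂, a1]⟩).mono le_rfl ?_
  rintro s₃ ⟨hin₃, ha₃, hr₃, hfar⟩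
  refine .seq <| (runs_record hin₃.2.1).mono le_rfl ?_
  rintro s₄ ⟨hx₄, hr₄, hr₄', ha₄, hz₄⟩
  refine .seq <| .setReal <| .setReal ?_
  have h1r : scalarsToArray r 0 = r i₀ := scalarsToArray_apply r i₀
  have hz₃ : vectorFromArray (s₃.array 3) 0 = c i₀ := by rw [ha₃, hz]
  have hint := hfar.isIntersectingBall hr hΩ
  have hF : s₃.realReg 6 ≤ inputDiam (balls c r) := by
    obtain ⟨i, -, -, h6, -⟩ := hfar
    rw [h6, hz₃]
    linarith [norm_sub_le_inputDiam (c := c) hr i₀ i, hr i]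
  refine ⟨(s₃.realReg 6 + r i₀) ^ 2, ?_, ?_, ?_, ?_, ?_, ?_, ?_, ?_, ?_⟩
  · have := radius_le_inputDiam (c := c) hd hr i₀
    exact pow_le_pow_left₀ (add_nonneg hint.1 (hr i₀)) (by linarith) 2
  · obtain ⟨h0, h1, a0, a1⟩ := hin₃
    exact ⟨by simp [hx₄, h0], by simp [hx₄, h1], by simp [ha₄, a0], by simp [ha₄, a1]⟩
  · simp [hr₄, hr₃, hr₂, hE]
  · simp [RealExpr.eval, NatExpr.eval, hr₄, ha₄, hin₃.2.2.2, h1r, pow_two]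
  · simpa [IsFarthest, hx₄, hr₄, ha₄] using hfar
  · simp [hr₄, hr₄']
  · simpa [hz₄, hr₄'] using hint
  · simp [RealExpr.eval]
  · intro w ρ hw hlt
    have hρ : ρ ≤ s₃.realReg 6 := by
      have hlt' : (1 + min ε 1) * ρ < s₃.realReg 6 := by simpa [hr₄'] using hlt
      nlinarith [mul_nonneg (lt_min hε one_pos).le hw.1]
    have h2 : ‖c i₀ - w‖ ≤ s₃.realReg 6 + r i₀ := by
      rw [norm_sub_rev]
      linarith [((isIntersectingBall_balls_iff hr).1 hw).2 i₀]
    simpa [RealExpr.eval, ha₄, hz₃] using pow_le_pow_left₀ (norm_nonneg _) h2 2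

theorem runs_iteration (hr : ∀ i, 0 ≤ r i) (hΩ : (⋂ i, balls c r i) = ∅) (hε : 0 < ε) {B : ℝ} {k : ℕ}
    (hs : Invariant c r ε B k s) :
    Runs iteration s (n * (d * 27 + 44) + d * 41 + 45) (Invariant c r ε B (k + 1)) := by
  obtain ⟨hin, h2, h4, ⟨i, hi5, hi7, hi6, hle⟩, hbest, hball, hsum, happ⟩ := hs
  have hE : 0 < min ε 1 := lt_min hε one_pos
  have hE1 : min ε 1 ≤ 1 := min_le_right _ _
  have hopt := optRadius_pos hr hΩ
  have hF : optRadius (balls c r) ≤ s.realReg 6 := (optRadius_le hball).trans hbest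
  refine .mono (.seq <| (runs_step hin hi5).mono le_rfl ?_)
    (T := d * 27 + 20 + (n * (d * 27 + 44) + 10 + (3 + (d * 14 + 8) + 1))) (by omega) fun _ h => h
  rintro s₁ ⟨hin₁, h1₁, h2₁, h4₁, h3₁, a2₁, hz₁⟩
  refine .seq <| (runs_farthest hΩ hin₁).mono le_rfl ?_
  rintro s₂ ⟨hin₂, ha₂, hr₂, hfar⟩
  have hsum₂ : (k + 1 : ℕ) * (min ε 1 * optRadius (balls c r) / 2) ^ 2 ≤ s₂.realReg 3 := by
    have : (min ε 1 * optRadius (balls c r) / 2) ^ 2 ≤ (min ε 1 * s.realReg 6 / 2) ^ 2 := by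
      gcongr
    rw [hr₂ 3 (by norm_num) (by norm_num) (by norm_num), h3₁, h2]
    push_cast
    linarith
  have happ₂ : ∀ w ρ, IsIntersectingBall (balls c r) w ρ → (1 + min ε 1) * ρ < s.realReg 1 →
      ‖vectorFromArray (s₂.array 3) 0 - w‖ ^ 2 + s₂.realReg 3 ≤ B := by
    intro w ρ hw hlt
    have hη : 0 ≤ min ε 1 * s.realReg 6 / 2 := by
      have := hopt.trans_le hF
      positivity
    -- From f > (1 + E)ρ follows f − ρ ≥ E f/(1 + E), which is at least E f/2 because E ≤ 1.
    have hρ : min ε 1 * s.realReg 6 / 2 ≤ s.realReg 6 - ρ := by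
      have h0 := hw.1
      nlinarith
    have hw' := ((isIntersectingBall_balls_iff hr).1 hw).2 i
    have hz : 0 < ‖vectorFromArray (s.array 3) 0 - c i‖ := by linarith [hr i]
    have key := norm_sub_smul_sub_sq_le (w := w) (δ := s.realReg 6 - ρ) hη hz (by linarith)
    have := happ w ρ hw hlt
    rw [ha₂, hz₁, hr₂ 3 (by norm_num) (by norm_num) (by norm_num), h3₁, h2, hi7]
    -- With η ≤ δ the change −2ηδ + η² is at most −η², which pays for the growth of the sum.
    nlinarith
  refine Runs.mono (.ite (T := d * 14 + 8) (fun hb => ?_) fun hb => ?_)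
    (by simp [Test.cost, RealExpr.cost]) fun _ h => h
  · have hlt : s₂.realReg 6 < s.realReg 1 := by
      simpa [Test.Holds, RealExpr.eval, hr₂, h1₁] using hb
    refine (runs_record hin₂.2.1).mono le_rfl ?_
    rintro s₃ ⟨hx₃, hr₃, hr₃', ha₃, hz₃⟩
    refine ⟨?_, ?_, ?_, ?_, ?_, ?_, ?_, ?_⟩
    · obtain ⟨h0, h1, a0, a1⟩ := hin₂
      exact ⟨by simp [hx₃, h0], by simp [hx₃, h1], by simp [ha₃, a0], by simp [ha₃, a1]⟩
    · simp [hr₃, hr₂, h2₁, h2]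
    · simp [hr₃, hr₂, h4₁, h4]
    · simpa [IsFarthest, hx₃, hr₃, ha₃] using hfar
    · simp [hr₃, hr₃']
    · rw [hz₃, hr₃']
      exact hfar.isIntersectingBall hr hΩ
    · rwa [hr₃ 3 (by norm_num)]
    · intro w ρ hw hlt'
      rw [hr₃ 3 (by norm_num), ha₃ 3 (by norm_num)]
      -- The record has dropped, so any w relevant to the new record was relevant to the old one.
      exact happ₂ w ρ hw (by linarith)
  · have hnlt : ¬ s₂.realReg 6 < s.realReg 1 := by
      simpa [Test.Holds, RealExpr.eval, hr₂, h1₁] using hb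
    have h1₂ : s₂.realReg 1 = s.realReg 1 := by simp [hr₂, h1₁]
    refine Runs.mono (.skip ?_) (by omega) fun _ h => h
    refine ⟨hin₂, by simp [hr₂, h2₁, h2], by simp [hr₂, h4₁, h4], hfar, ?_, ?_, hsum₂, ?_⟩
    · rw [h1₂]
      exact not_lt.1 hnlt
    · rwa [h1₂, ha₂, a2₁]
    · rwa [h1₂]

theorem runs_sibProgram (hr : ∀ i, 0 ≤ r i) (hΩ : (⋂ i, balls c r i) = ∅) (hε : 0 < ε) :
    Runs sibProgram (initState c r ε)
      ((⌊16 * (inputDiam (balls c r) / optRadius (balls c r)) ^ 2 / min ε 1 ^ 2⌋₊ + 1) *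
        (n * (d * 27 + 44) + d * 41 + 50) + (n * (d * 27 + 44) + d * 28 + 50)) fun s =>
      IsApproxSIB (balls c r) ε (vectorFromArray (s.array 2) 0) (s.realReg 1) := by
  have hE : 0 < min ε 1 := lt_min hε one_pos
  have hopt := optRadius_pos hr hΩ
  refine .mono (.seq <| (runs_setup hr hΩ hε).mono le_rfl ?_)
    (T := n * (d * 27 + 44) + d * 28 + 45 +
      ((⌊16 * (inputDiam (balls c r) / optRadius (balls c r)) ^ 2 / min ε 1 ^ 2⌋₊ + 1) *
        (n * (d * 27 + 44) + d * 41 + 50) + 5)) (by omega) fun _ h => h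
  rintro s₀ ⟨B, hB, hs₀⟩
  refine Runs.mono (.loop (Invariant c r ε B) (T := n * (d * 27 + 44) + d * 41 + 45)
    (⌊16 * (inputDiam (balls c r) / optRadius (balls c r)) ^ 2 / min ε 1 ^ 2⌋₊ + 1)
    hs₀ ?_ ?_) ?_ fun _ h => h
  · intro k s hs hb
    -- While the test holds, k (E r*/2)² ≤ Σ η² ≤ B ≤ 4D², so k ≤ 16 R²/E².
    refine ⟨Nat.lt_succ_of_le (Nat.le_floor ?_), runs_iteration hr hΩ hε hs⟩
    have hle : s.realReg 3 ≤ B := by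
      simpa [Test.Holds, RealExpr.eval, hs.reg_four] using hb
    have := hs.le_sum
    rw [div_pow, mul_div_assoc', div_div, le_div_iff₀ (by positivity)]
    nlinarith
  · intro k s hs hb
    have hlt : B < s.realReg 3 := by
      simpa [Test.Holds, RealExpr.eval, hs.reg_four] using hb
    refine ⟨hs.isIntersectingBall, le_of_not_gt fun hgt => ?_⟩
    have hgt' : (1 + min ε 1) * optRadius (balls c r) < s.realReg 1 :=
      lt_of_le_of_lt (by gcongr; exact min_le_left _ _) hgt
    -- A record above (1 + E) r* leaves room for a ball with (1 + E)ρ below it, and `approach` then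
    -- contradicts Σ η² > B.
    obtain ⟨w, ρ, hw, hρ⟩ := exists_isIntersectingBall_lt (c := c) hr
      ((lt_div_iff₀' (by positivity)).2 hgt')
    have := hs.approach w ρ hw ((lt_div_iff₀' (by positivity)).1 hρ)
    nlinarith [sq_nonneg ‖vectorFromArray (s.array 3) 0 - w‖]
  · simp only [Test.cost, RealExpr.cost]
    ring_nf
    omega

end SIB

/-! ### From the step count to the asymptotic bound -/

namespace SIB

variable {n d : ℕ} {c : Fin n → EuclideanSpace ℝ (Fin d)} {r : Fin n → ℝ}

theorem optRadius_le_inputDiam (hr : ∀ i, 0 ≤ r i) (hΩ : (⋂ i, balls c r i) = ∅) :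
    optRadius (balls c r) ≤ inputDiam (balls c r) := by
  have hn := two_le_of_iInter_eq_empty hr hΩ
  let i₀ : Fin n := ⟨0, by omega⟩
  refine optRadius_le (z := c i₀) ((isIntersectingBall_balls_iff hr).2 ⟨?_, fun i => ?_⟩)
  · exact (norm_nonneg _).trans (norm_sub_le_inputDiam (c := c) hr i₀ i₀)
  · linarith [norm_sub_le_inputDiam (c := c) hr i₀ i, hr i]

/-- Since R ≥ 1 ≥ E, the additive terms are absorbed into X = R²/E² ≥ 1: K + 2 ≤ 18 X, and 18 · 162
≤ 6000/2. The factor log n is slack; only log n ≥ 1/2, from n ≥ 2, is used. -/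
theorem sibProgram_time_le (hr : ∀ i, 0 ≤ r i) (hΩ : (⋂ i, balls c r i) = ∅) {ε : ℝ} (hε : 0 < ε)
    {t : ℕ} (ht : t ≤
      (⌊16 * (inputDiam (balls c r) / optRadius (balls c r)) ^ 2 / min ε 1 ^ 2⌋₊ + 1) *
        (n * (d * 27 + 44) + d * 41 + 50) + (n * (d * 27 + 44) + d * 28 + 50)) :
    (t : ℝ) ≤ 6000 * ((inputDiam (balls c r) / optRadius (balls c r)) ^ 2 *
      (n * d) * Real.log n / (min ε 1) ^ 2) := by
  have hE : 0 < min ε 1 := lt_min hε one_pos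
  have hn := two_le_of_iInter_eq_empty hr hΩ
  have hd := dim_pos_of_iInter_eq_empty hr hΩ
  have hR : 1 ≤ inputDiam (balls c r) / optRadius (balls c r) :=
    (one_le_div (optRadius_pos hr hΩ)).2 (optRadius_le_inputDiam hr hΩ)
  set X := (inputDiam (balls c r) / optRadius (balls c r)) ^ 2 / min ε 1 ^ 2 with hX
  have hX1 : 1 ≤ X := by
    rw [hX, ← div_pow]
    exact one_le_pow₀ ((one_le_div hE).2 ((min_le_right _ _).trans hR))
  have hK : ((⌊16 * (inputDiam (balls c r) / optRadius (balls c r)) ^ 2 / min ε 1 ^ 2⌋₊ : ℕ) : ℝ)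
      ≤ 16 * X := (Nat.floor_le (by positivity)).trans_eq (mul_div_assoc _ _ _)
  set K := ⌊16 * (inputDiam (balls c r) / optRadius (balls c r)) ^ 2 / min ε 1 ^ 2⌋₊
  have hlog : 1 / 2 ≤ Real.log n :=
    (by linarith [Real.log_two_gt_d9] : (1 : ℝ) / 2 ≤ Real.log 2).trans
      (Real.log_le_log two_pos (by exact_mod_cast hn))
  have h1 : n * (d * 27 + 44) + d * 41 + 50 ≤ 162 * (n * d) := by nlinarith
  have h2 : n * (d * 27 + 44) + d * 28 + 50 ≤ 162 * (n * d) := by omega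
  have h3 : (t : ℝ) ≤ (K + 2) * (162 * (n * d)) := by
    have : t ≤ (K + 2) * (162 * (n * d)) := by
      calc t ≤ _ := ht
        _ ≤ (K + 1) * (162 * (n * d)) + 162 * (n * d) := by gcongr
        _ = _ := by ring
    exact_mod_cast this
  calc (t : ℝ) ≤ (K + 2) * (162 * (n * d)) := h3
    _ ≤ (18 * X) * (162 * (n * d)) := by gcongr; linarith
    _ ≤ 6000 * (X * (n * d)) * (1 / 2) := by nlinarith [show 0 ≤ X * ((n : ℝ) * d) by positivity]
    _ ≤ 6000 * (X * (n * d)) * Real.log n := by gcongr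
    _ = _ := by rw [hX]; ring

end SIB

/-- Output conventions: the linear minimizers are written to the array `3`; the center of the
approximate smallest intersecting ball is written to the array `2` and its radius to the real
register `1`. -/
theorem mainTheorem6 :
    -- the closed form of the minimizer of a linear function over a ball
    (∀ (d : ℕ) (c h : EuclideanSpace ℝ (Fin d)) (r : ℝ), 0 ≤ r → h ≠ 0 →
      SIB.IsLinearMinimizer (Metric.closedBall c r) h (c - (r / ‖h‖) • h)) ∧
    -- `n` such linear minimizations are solved by the closed form in `O(n d)` steps
    (∃ (P : RealRAM.Cmd) (C : ℝ),
      ∀ (n d : ℕ) (c h : Fin n → EuclideanSpace ℝ (Fin d)) (r : Fin n → ℝ),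
        1 ≤ n → 1 ≤ d → (∀ i, 0 ≤ r i) →
        ∃ (s : RealRAM.State) (t : ℕ),
          RealRAM.Exec P (SIB.initStateLinear c r h) s t ∧
          (t : ℝ) ≤ C * (n * d) ∧
          ∀ i : Fin n,
            SIB.IsLinearMinimizer (SIB.balls c r i) (h i)
              (SIB.vectorFromArray (s.array 3) (i * d)) ∧
            (h i ≠ 0 →
              SIB.vectorFromArray (s.array 3) (i * d) = c i - (r i / ‖h i‖) • h i)) ∧
    -- a `(1 + ε)`-approximate smallest intersecting ball in `O(R² n d log n / ε²)` steps
    (∃ (P : RealRAM.Cmd) (C : ℝ),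
      ∀ (n d : ℕ) (c : Fin n → EuclideanSpace ℝ (Fin d)) (r : Fin n → ℝ) (ε : ℝ),
        (∀ i, 0 ≤ r i) → (⋂ i, SIB.balls c r i) = ∅ → 0 < ε →
        ∃ (s : RealRAM.State) (t : ℕ),
          RealRAM.Exec P (SIB.initState c r ε) s t ∧
          SIB.IsApproxSIB (SIB.balls c r) ε
            (SIB.vectorFromArray (s.array 2) 0) (s.realReg 1) ∧
          (t : ℝ) ≤ C * ((SIB.inputDiam (SIB.balls c r) / SIB.optRadius (SIB.balls c r)) ^ 2 *
            (n * d) * Real.log n / (min ε 1) ^ 2)) := by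
  refine ⟨fun d c h r hr _ => SIB.isLinearMinimizer_closedBall c h hr, ?_, ?_⟩
  -- 82 = 48 + 26 + 8, as n and d are at least 1.
  · refine ⟨SIB.linearProgram, 82, fun n d c h r hn hd hr => ?_⟩
    obtain ⟨s, t, he, ht, hu⟩ := SIB.runs_linearProgram (c := c) (h := h) (r := r)
    refine ⟨s, t, he, ?_, fun i => ⟨?_, fun _ => hu i⟩⟩
    · have : t ≤ 82 * (n * d) := by nlinarith
      exact_mod_cast this
    · rw [hu i]
      exact SIB.isLinearMinimizer_closedBall _ _ (hr i)
  · refine ⟨SIB.sibProgram, 6000, fun n d c r ε hr hΩ hε => ?_⟩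
    obtain ⟨s, t, he, ht, hs⟩ := SIB.runs_sibProgram hr hΩ hε
    exact ⟨s, t, he, hs, SIB.sibProgram_time_le hr hΩ hε ht⟩
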